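/- Let $V$ be the sequence defined by $V(1)=V(2)=V(3)=V(4)=1$ and $V(n)=V(n-V(n-1))+V(n-V(n-4))$ for $n>4$. Let $F(a)=\#\{n\ge 1: V(n)=a\}$ for integers $a\ge 1$, and $F(a)=0$ for integers $a\le 0$. Both are well defined: for $n>4$ one has $1\le V(n-1)<n$ and $1\le V(n-4)<n$, so that the recursion only uses earlier terms, and each value is taken by $V$ only finitely often. A deterministic finite automaton with output consists of a finite set of states, an initial state, a transition function $\delta$ and an output map $\tau$. All automata here have input alphabet $\{0,1\}$, and read binary words $w$ from left to right, most significant digit first, leading zeros being allowed; $[w]$ denotes the integer that $w$ represents in base $2$, with $[\varepsilon]=0$. The automata $A$ and $B$ have binary strings as names of states and the empty string $\varepsilon$ as initial state; in the lists below an entry $q:p,p',t$ means $\delta(q,0)=p$, $\delta(q,1)=p'$ and that the output of the state $q$ is $t$, where a quadruple is written as a string of four digits. Automaton $A$ (outputs in $\{0,1,2,3,4\}^4$): $\varepsilon:\varepsilon,1,0004$; $1:10,11,0041$; $10:100,101,0411$; $11:110,111,4111$; $100:1000,110,1112$; $101:1010,1011,1122$; $110:1100,1101,1221$; $111:1110,110,2212$;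 $1000:1010,1011,2122$; $1010:1110,10101,2213$; $1011:10110,10111,2132$; $1100:1101,1110,1321$; $1101:11010,11011,3212$; $1110:11100,11101,2122$; $10101:101010,101011,1223$; $10110:10110,10111,2232$; $10111:1101,1110,2321$; $11010:101010,110101,1222$; $11011:111,1000,2221$; $11100:11010,111001,2213$; $11101:111010,10111,2132$; $101010:1010100,11101,1322$; $101011:101010,101011,3223$; $110101:1100,1101,3221$; $111001:1010,1110011,2223$; $111010:1110100,1110101,2232$; $1010100:11010,111001,3213$; $1110011:10110,11100111,2133$; $1110100:11101000,10111,1332$; $1110101:1101,1110,3321$; $11100111:1010100,111001111,2323$; $11101000:1110100,1110101,3232$; $111001111:111010,11100111,2133$. Automaton $B$ (outputs in $\{0,1,2,3,4\}$): $\varepsilon:\varepsilon,1,0$; $1:10,11,4$; $10:100,101,1$; $11:110,111,1$; $100:101,110,1$; $101:1010,1011,2$; $110:1100,1101,2$; $111:1110,110,1$; $1010:1110,10101,1$; $1011:1011,1100,3$; $1100:1101,1110,2$; $1101:11010,11011,1$; $1110:11100,1011,2$; $10101:1110,10101,2$; $11010:1110,110,2$; $11011:111,101,2$; $11100:11010,111001,1$;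 $111001:1010,1110011,2$; $1110011:1011,11100111,3$; $11100111:11100,1110011,2$. Then: 1. $A$ has $33$ states, and for every binary word $w$ with $n=[w]$, the state that $A$ reaches on reading $w$ has output $(F(n-2),F(n-1),F(n),F(n+1))$. 2. $B$ has $20$ states. Replace the output map of $A$ by its third component and minimize, that is, remove the states that cannot be reached from the initial state, and merge two states $p,q$ if and only if for every word $x$ the states reached from $p$ and from $q$ on reading $x$ have the same output. The resulting automaton is isomorphic to $B$. 3. $B$ computes $F$: for every binary word $w$, the state that $B$ reaches on reading $w$ has output $F([w])$. Every finite automaton with output in $\{0,1,2,3,4\}$ that computes $F$ in this sense has at least $20$ states. -/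

import Mathlib

/-- The Hofstadter–Huber sequence `V = Q_{1,4}`: `V 1 = V 2 = V 3 = V 4 = 1` and
`V n = V (n - V (n - 1)) + V (n - V (n - 4))` for `n > 4`.  The index `0` does not belong to the
sequence; its value, and the value in the `else` branch (which is never taken), are defaults.  The test
makes the two arguments smaller than `n`, so that this is a recursion. -/
def hofV (n : ℕ) : ℕ :=
  if _hn : n ≤ 4 then (if n = 0 then 0 else 1)
  else if _h : 1 ≤ hofV (n - 1) ∧ 1 ≤ hofV (n - 4) then
    hofV (n - hofV (n - 1)) + hofV (n - hofV (n - 4))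
  else 0
termination_by n
decreasing_by all_goals omega

/-- The frequency sequence `F a = #{n ≥ 1 : V n = a}` for `a ≥ 1`, extended by `F a = 0` for
`a ≤ 0`. -/
noncomputable def hofF (a : ℤ) : ℕ :=
  if 1 ≤ a then {n : ℕ | 1 ≤ n ∧ (hofV n : ℤ) = a}.ncard else 0

/-- The integer represented in base 2 by a word, most significant digit first
(leading zeros allowed, the empty word represents `0`). -/
def binValue (w : List (Fin 2)) : ℕ :=
  Nat.ofDigits 2 (w.reverse.map Fin.val)

/-- A complete deterministic automaton with output. -/
structure DFAO (α σ Δ : Type*) where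
  step : σ → α → σ
  start : σ
  out : σ → Δ

namespace DFAO

/-- The state reached from `q` by reading the word from left to right. -/
def evalFrom {α σ Δ : Type*} (M : DFAO α σ Δ) (q : σ) (w : List α) : σ :=
  w.foldl M.step q

/-- The state reached from the initial state. -/
def eval {α σ Δ : Type*} (M : DFAO α σ Δ) (w : List α) : σ :=
  M.evalFrom M.start w

/-- The same automaton with its outputs transformed by `f`. -/
def mapOut {α σ Δ Δ' : Type*} (M : DFAO α σ Δ) (f : Δ → Δ') : DFAO α σ Δ' where
  step := M.step
  start := M.start
  out := fun q => f (M.out q)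

/-- The states that can be reached from the initial state. -/
def Reachable {α σ Δ : Type*} (M : DFAO α σ Δ) : Type _ :=
  {q : σ // ∃ w : List α, M.eval w = q}

/-- Two reachable states are equivalent if no word distinguishes them by its output. -/
def stateSetoid {α σ Δ : Type*} (M : DFAO α σ Δ) : Setoid M.Reachable where
  r p q := ∀ w : List α, M.out (M.evalFrom p.1 w) = M.out (M.evalFrom q.1 w)
  iseqv := ⟨fun _ _ => rfl, fun h w => (h w).symm, fun h₁ h₂ w => (h₁ w).trans (h₂ w)⟩

/-- The minimization of an automaton: unreachable states are removed and equivalent states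
are merged. -/
def minimize {α σ Δ : Type*} (M : DFAO α σ Δ) : DFAO α (Quotient M.stateSetoid) Δ where
  step := fun c a => Quotient.map
    (fun q : M.Reachable => (⟨M.step q.1 a, by
      obtain ⟨w, hw⟩ := q.2
      exact ⟨w ++ [a], by rw [← hw]; simp [eval, evalFrom]⟩⟩ : M.Reachable))
    (fun p q (h : ∀ w, M.out (M.evalFrom p.1 w) = M.out (M.evalFrom q.1 w)) w => h (a :: w)) c
  start := Quotient.mk _ ⟨M.start, [], rfl⟩
  out := Quotient.lift (fun q : M.Reachable => M.out q.1) (fun _ _ h => h [])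

/-- Isomorphism of automata: a renaming of the states. -/
def IsIsomorphic {α σ σ' Δ : Type*} (M : DFAO α σ Δ) (N : DFAO α σ' Δ) : Prop :=
  ∃ e : σ ≃ σ', e M.start = N.start ∧ (∀ q a, e (M.step q a) = N.step (e q) a) ∧
    ∀ q, N.out (e q) = M.out q

end DFAO

/-- The states of the automaton `A`, named by binary strings; `eps` is the empty string. -/
inductive StateA where
  | eps | s1 | s10 | s11 | s100
  | s101 | s110 | s111 | s1000 | s1010
  | s1011 | s1100 | s1101 | s1110 | s10101
  | s10110 | s10111 | s11010 | s11011 | s11100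
  | s11101 | s101010 | s101011 | s110101 | s111001
  | s111010 | s1010100 | s1110011 | s1110100 | s1110101
  | s11100111 | s11101000 | s111001111
  deriving DecidableEq

instance : Fintype StateA where
  elems := {.eps, .s1, .s10, .s11, .s100, .s101,
    .s110, .s111, .s1000, .s1010, .s1011, .s1100,
    .s1101, .s1110, .s10101, .s10110, .s10111, .s11010,
    .s11011, .s11100, .s11101, .s101010, .s101011, .s110101,
    .s111001, .s111010, .s1010100, .s1110011, .s1110100, .s1110101,
    .s11100111, .s11101000, .s111001111}
  complete := by intro q; cases q <;> decide

/-- The transition function of `A`. -/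
def stepA : StateA → Fin 2 → StateA
  | .eps, 0 => .eps
  | .eps, 1 => .s1
  | .s1, 0 => .s10
  | .s1, 1 => .s11
  | .s10, 0 => .s100
  | .s10, 1 => .s101
  | .s11, 0 => .s110
  | .s11, 1 => .s111
  | .s100, 0 => .s1000
  | .s100, 1 => .s110
  | .s101, 0 => .s1010
  | .s101, 1 => .s1011
  | .s110, 0 => .s1100
  | .s110, 1 => .s1101
  | .s111, 0 => .s1110
  | .s111, 1 => .s110
  | .s1000, 0 => .s1010
  | .s1000, 1 => .s1011
  | .s1010, 0 => .s1110
  | .s1010, 1 => .s10101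
  | .s1011, 0 => .s10110
  | .s1011, 1 => .s10111
  | .s1100, 0 => .s1101
  | .s1100, 1 => .s1110
  | .s1101, 0 => .s11010
  | .s1101, 1 => .s11011
  | .s1110, 0 => .s11100
  | .s1110, 1 => .s11101
  | .s10101, 0 => .s101010
  | .s10101, 1 => .s101011
  | .s10110, 0 => .s10110
  | .s10110, 1 => .s10111
  | .s10111, 0 => .s1101
  | .s10111, 1 => .s1110
  | .s11010, 0 => .s101010
  | .s11010, 1 => .s110101
  | .s11011, 0 => .s111
  | .s11011, 1 => .s1000
  | .s11100, 0 => .s11010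
  | .s11100, 1 => .s111001
  | .s11101, 0 => .s111010
  | .s11101, 1 => .s10111
  | .s101010, 0 => .s1010100
  | .s101010, 1 => .s11101
  | .s101011, 0 => .s101010
  | .s101011, 1 => .s101011
  | .s110101, 0 => .s1100
  | .s110101, 1 => .s1101
  | .s111001, 0 => .s1010
  | .s111001, 1 => .s1110011
  | .s111010, 0 => .s1110100
  | .s111010, 1 => .s1110101
  | .s1010100, 0 => .s11010
  | .s1010100, 1 => .s111001
  | .s1110011, 0 => .s10110
  | .s1110011, 1 => .s11100111
  | .s1110100, 0 => .s11101000
  | .s1110100, 1 => .s10111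
  | .s1110101, 0 => .s1101
  | .s1110101, 1 => .s1110
  | .s11100111, 0 => .s1010100
  | .s11100111, 1 => .s111001111
  | .s11101000, 0 => .s1110100
  | .s11101000, 1 => .s1110101
  | .s111001111, 0 => .s111010
  | .s111001111, 1 => .s11100111

/-- The output map of `A`. -/
def outA : StateA → Fin 4 → Fin 5
  | .eps => ![0, 0, 0, 4]
  | .s1 => ![0, 0, 4, 1]
  | .s10 => ![0, 4, 1, 1]
  | .s11 => ![4, 1, 1, 1]
  | .s100 => ![1, 1, 1, 2]
  | .s101 => ![1, 1, 2, 2]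
  | .s110 => ![1, 2, 2, 1]
  | .s111 => ![2, 2, 1, 2]
  | .s1000 => ![2, 1, 2, 2]
  | .s1010 => ![2, 2, 1, 3]
  | .s1011 => ![2, 1, 3, 2]
  | .s1100 => ![1, 3, 2, 1]
  | .s1101 => ![3, 2, 1, 2]
  | .s1110 => ![2, 1, 2, 2]
  | .s10101 => ![1, 2, 2, 3]
  | .s10110 => ![2, 2, 3, 2]
  | .s10111 => ![2, 3, 2, 1]
  | .s11010 => ![1, 2, 2, 2]
  | .s11011 => ![2, 2, 2, 1]
  | .s11100 => ![2, 2, 1, 3]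
  | .s11101 => ![2, 1, 3, 2]
  | .s101010 => ![1, 3, 2, 2]
  | .s101011 => ![3, 2, 2, 3]
  | .s110101 => ![3, 2, 2, 1]
  | .s111001 => ![2, 2, 2, 3]
  | .s111010 => ![2, 2, 3, 2]
  | .s1010100 => ![3, 2, 1, 3]
  | .s1110011 => ![2, 1, 3, 3]
  | .s1110100 => ![1, 3, 3, 2]
  | .s1110101 => ![3, 3, 2, 1]
  | .s11100111 => ![2, 3, 2, 3]
  | .s11101000 => ![3, 2, 3, 2]
  | .s111001111 => ![2, 1, 3, 3]

/-- The automaton `A`. -/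
def autA : DFAO (Fin 2) StateA (Fin 4 → Fin 5) where
  step := stepA
  start := .eps
  out := outA

/-- The states of the automaton `B`, named by binary strings; `eps` is the empty string. -/
inductive StateB where
  | eps | s1 | s10 | s11 | s100
  | s101 | s110 | s111 | s1010 | s1011
  | s1100 | s1101 | s1110 | s10101 | s11010
  | s11011 | s11100 | s111001 | s1110011 | s11100111
  deriving DecidableEq

instance : Fintype StateB where
  elems := {.eps, .s1, .s10, .s11, .s100, .s101,
    .s110, .s111, .s1010, .s1011, .s1100, .s1101,
    .s1110, .s10101, .s11010, .s11011, .s11100, .s111001,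
    .s1110011, .s11100111}
  complete := by intro q; cases q <;> decide

/-- The transition function of `B`. -/
def stepB : StateB → Fin 2 → StateB
  | .eps, 0 => .eps
  | .eps, 1 => .s1
  | .s1, 0 => .s10
  | .s1, 1 => .s11
  | .s10, 0 => .s100
  | .s10, 1 => .s101
  | .s11, 0 => .s110
  | .s11, 1 => .s111
  | .s100, 0 => .s101
  | .s100, 1 => .s110
  | .s101, 0 => .s1010
  | .s101, 1 => .s1011
  | .s110, 0 => .s1100
  | .s110, 1 => .s1101
  | .s111, 0 => .s1110
  | .s111, 1 => .s110
  | .s1010, 0 => .s1110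
  | .s1010, 1 => .s10101
  | .s1011, 0 => .s1011
  | .s1011, 1 => .s1100
  | .s1100, 0 => .s1101
  | .s1100, 1 => .s1110
  | .s1101, 0 => .s11010
  | .s1101, 1 => .s11011
  | .s1110, 0 => .s11100
  | .s1110, 1 => .s1011
  | .s10101, 0 => .s1110
  | .s10101, 1 => .s10101
  | .s11010, 0 => .s1110
  | .s11010, 1 => .s110
  | .s11011, 0 => .s111
  | .s11011, 1 => .s101
  | .s11100, 0 => .s11010
  | .s11100, 1 => .s111001
  | .s111001, 0 => .s1010
  | .s111001, 1 => .s1110011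
  | .s1110011, 0 => .s1011
  | .s1110011, 1 => .s11100111
  | .s11100111, 0 => .s11100
  | .s11100111, 1 => .s1110011

/-- The output map of `B`. -/
def outB : StateB → Fin 5
  | .eps => 0
  | .s1 => 4
  | .s10 => 1
  | .s11 => 1
  | .s100 => 1
  | .s101 => 2
  | .s110 => 2
  | .s111 => 1
  | .s1010 => 1
  | .s1011 => 3
  | .s1100 => 2
  | .s1101 => 1
  | .s1110 => 2
  | .s10101 => 2
  | .s11010 => 2
  | .s11011 => 2
  | .s11100 => 1
  | .s111001 => 2
  | .s1110011 => 3
  | .s11100111 => 2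

/-- The automaton `B`. -/
def autB : DFAO (Fin 2) StateB (Fin 5) where
  step := stepB
  start := .eps
  out := outB

/-!
The automaton `A` defines a candidate `freq` for the frequency sequence, the third output of the
state reached on the binary expansion.  Its partial sums `cum` cut the positive integers into
blocks, and the theorem is that `hofV` takes the value `b + 1` exactly on the block
`cum b < n ≤ cum (b + 1)`.  Only this has to be verified, by strong induction on `n` (`hofV_eq_of_mem_block`).

The nested recursion can be checked locally because the partial sums are tied together at the
scales `m` and `2 m`: `cum (2 m) = cum m + 2 m + d`, where `d ∈ {0, -1, -2}` depends only on the
state of `A` at `m` (`cum_two_mul`).  If `n` lies in the block of `a = 2 m + e`, then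
`n - V (n - 1)` and `n - V (n - 4)` therefore lie at positions relative to `cum m` that are determined by the
state at `m` and the digit `e`, and the blocks containing them are read off from the four outputs
of that state (`block_of_inBlock`).  So the recursion becomes a statement about the states and
digits (`recursion_check`), decided by enumeration.  That the four outputs form a sliding window,
and that `d` is a function of the state, follow from the list of the states that can occur at
`m + 1` when the state at `m` is given (`nextA`), which is closed under the passage from `m` to `2 m`
and `2 m + 1`.

The automaton `B` is the image of `A` under a surjective homomorphism `toB`, and any two of its
states are told apart by one of five words (`fingerprint_injective`); this gives both the
minimization of `A` and the lower bound on the number of states.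
-/

/-! ### The states of `A` along the integers -/

/-- The state of `A` after reading a binary expansion of `n`. -/
def stateA (n : ℕ) : StateA :=
  if n = 0 then .eps else stepA (stateA (n / 2)) (Fin.ofNat 2 n)
termination_by n
decreasing_by omega

lemma stateA_zero : stateA 0 = .eps := by rw [stateA, if_pos rfl]

lemma stateA_two_mul_add (m : ℕ) (e : Fin 2) : stateA (2 * m + e) = stepA (stateA m) e := by
  by_cases h : 2 * m + (e : ℕ) = 0
  · obtain rfl : m = 0 := by omega
    obtain rfl : e = 0 := Fin.ext (by simpa using h)
    simp [stateA_zero, stepA]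
  · rw [stateA, if_neg h]
    have h1 : (2 * m + (e : ℕ)) / 2 = m := by omega
    have h2 : Fin.ofNat 2 (2 * m + (e : ℕ)) = e := by
      apply Fin.ext
      simp only [Fin.ofNat]
      omega
    rw [h1, h2]

lemma stateA_two_mul (m : ℕ) : stateA (2 * m) = stepA (stateA m) 0 := stateA_two_mul_add m 0

lemma stateA_two_mul_add_one (m : ℕ) : stateA (2 * m + 1) = stepA (stateA m) 1 :=
  stateA_two_mul_add m 1

lemma stateA_one : stateA 1 = .s1 := by simpa [stateA_zero, stepA] using stateA_two_mul_add_one 0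

lemma stateA_of_two : stateA 2 = .s10 := by simpa [stateA_one, stepA] using stateA_two_mul 1

lemma binValue_append_singleton (w : List (Fin 2)) (e : Fin 2) :
    binValue (w ++ [e]) = 2 * binValue w + e := by
  simp [binValue, Nat.ofDigits_cons, add_comm]

lemma DFAO.eval_append_singleton {α σ Δ : Type*} (M : DFAO α σ Δ) (w : List α) (a : α) :
    M.eval (w ++ [a]) = M.step (M.eval w) a := by
  simp [DFAO.eval, DFAO.evalFrom]

lemma DFAO.eval_append {α σ Δ : Type*} (M : DFAO α σ Δ) (w x : List α) :
    M.eval (w ++ x) = M.evalFrom (M.eval w) x := by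
  simp [DFAO.eval, DFAO.evalFrom]

lemma autA_eval (w : List (Fin 2)) : autA.eval w = stateA (binValue w) := by
  induction w using List.reverseRecOn with
  | nil => simp [DFAO.eval, DFAO.evalFrom, binValue, stateA_zero, autA]
  | append_singleton w e ih =>
    rw [DFAO.eval_append_singleton, binValue_append_singleton, stateA_two_mul_add, ih]
    rfl

/-- The states that can occur at `m + 1` if the given state occurs at `m`. -/
def nextA : StateA → List StateA
  | .eps => [.s1]
  | .s1 => [.s10]
  | .s10 => [.s11]
  | .s11 => [.s100]
  | .s100 => [.s101]
  | .s101 => [.s110]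
  | .s110 | .s110101 => [.s111, .s1010]
  | .s111 => [.s1000]
  | .s1000 => [.s110, .s11010]
  | .s1010 => [.s1011, .s1110011]
  | .s1011 | .s11101 => [.s1100, .s101010]
  | .s1100 => [.s1101]
  | .s1101 => [.s1110]
  | .s1110 => [.s110, .s10101, .s11010]
  | .s10101 | .s101011 => [.s10110]
  | .s10110 | .s111010 => [.s10111, .s11100111]
  | .s10111 | .s1110101 => [.s1101, .s1010100]
  | .s11010 => [.s11011, .s111001]
  | .s11011 => [.s11100]
  | .s11100 => [.s11101]
  | .s101010 => [.s101011, .s110101]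
  | .s111001 => [.s111010]
  | .s1010100 => [.s11101, .s111001111]
  | .s1110011 | .s111001111 => [.s1110100]
  | .s1110100 => [.s1110101]
  | .s11100111 => [.s11101000]
  | .s11101000 => [.s10111]

lemma nextA_closed : ∀ p, ∀ r ∈ nextA p, stepA p 1 ∈ nextA (stepA p 0) ∧
    stepA r 0 ∈ nextA (stepA p 1) := by
  decide

lemma stateA_succ_mem (m : ℕ) : stateA (m + 1) ∈ nextA (stateA m) := by
  induction m using Nat.strong_induction_on with
  | _ m ih =>
    obtain ⟨k, rfl | rfl⟩ := Nat.even_or_odd' m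
    · rw [stateA_two_mul_add_one, stateA_two_mul]
      rcases Nat.eq_zero_or_pos k with rfl | hk
      · rw [stateA_zero]; decide
      · exact (nextA_closed _ _ (ih k (by omega))).1
    · rw [show 2 * k + 1 + 1 = 2 * (k + 1) by ring, stateA_two_mul, stateA_two_mul_add_one]
      exact (nextA_closed _ _ (ih k (by omega))).2

/-- The first three states of `A` are transient: they occur only at the integers `0, 1, 2`. -/
lemma stateA_of_three_le (m : ℕ) (hm : 3 ≤ m) :
    stateA m ≠ .eps ∧ stateA m ≠ .s1 ∧ stateA m ≠ .s10 := by
  have closed : ∀ p : StateA, p ≠ .eps ∧ p ≠ .s1 ∧ p ≠ .s10 → ∀ e : Fin 2,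
      stepA p e ≠ .eps ∧ stepA p e ≠ .s1 ∧ stepA p e ≠ .s10 := by decide
  induction m using Nat.strong_induction_on with
  | _ m ih =>
    obtain ⟨k, e, rfl⟩ : ∃ (k : ℕ) (e : Fin 2), m = 2 * k + e :=
      ⟨m / 2, ⟨m % 2, Nat.mod_lt _ two_pos⟩, by simp only; omega⟩
    rw [stateA_two_mul_add]
    by_cases hk : 3 ≤ k
    · exact closed _ (ih k (by omega) hk) e
    · obtain rfl | rfl : k = 1 ∨ k = 2 := by omega
      · obtain rfl : e = 1 := by
          apply Fin.ext
          simp only [Fin.val_one]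
          omega
        rw [stateA_one]; decide
      · rw [stateA_of_two]; clear * -; revert e; decide

/-! ### The candidate for the frequency sequence -/

/-- The third output of the state of `A` at `a`. -/
def freq (a : ℕ) : ℕ := outA (stateA a) 2

lemma freq_zero : freq 0 = 0 := by rw [freq, stateA_zero]; rfl

lemma freq_pos (a : ℕ) (ha : 1 ≤ a) : 1 ≤ freq a := by
  have key : ∀ p, ∀ r ∈ nextA p, 1 ≤ (outA r 2 : ℕ) := by decide
  obtain ⟨b, rfl⟩ := Nat.exists_eq_add_of_le' ha
  exact key _ _ (stateA_succ_mem b)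

lemma window_check : ∀ p, ∀ r ∈ nextA p,
    outA r 0 = outA p 1 ∧ outA r 1 = outA p 2 ∧ outA r 2 = outA p 3 := by
  decide

lemma outA_three (m : ℕ) : (outA (stateA m) 3 : ℕ) = freq (m + 1) := by
  rw [freq, (window_check _ _ (stateA_succ_mem m)).2.2]

lemma outA_one (m : ℕ) : (outA (stateA (m + 1)) 1 : ℕ) = freq m := by
  rw [freq, (window_check _ _ (stateA_succ_mem m)).2.1]

lemma outA_zero (m : ℕ) : (outA (stateA (m + 2)) 0 : ℕ) = freq m := by
  rw [(window_check _ _ (stateA_succ_mem (m + 1))).1, outA_one]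

/-- The partial sums `freq 1 + ⋯ + freq a`. -/
def cum (a : ℕ) : ℕ := ∑ b ∈ Finset.range a, freq (b + 1)

lemma cum_zero : cum 0 = 0 := rfl

lemma cum_succ (a : ℕ) : cum (a + 1) = cum a + freq (a + 1) := Finset.sum_range_succ _ _

lemma cum_strictMono : StrictMono cum :=
  strictMono_nat_of_lt_succ fun a => by
    have := freq_pos (a + 1) (by omega)
    rw [cum_succ]; omega

lemma exists_block (n : ℕ) (hn : 1 ≤ n) : ∃ b, cum b < n ∧ n ≤ cum (b + 1) := by
  have hex : ∃ a, n ≤ cum a := ⟨n, cum_strictMono.le_apply⟩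
  obtain ⟨b, hb⟩ : ∃ b, Nat.find hex = b + 1 := by
    refine Nat.exists_eq_succ_of_ne_zero fun h => ?_
    have := Nat.find_spec hex
    rw [h, cum_zero] at this
    omega
  exact ⟨b, not_le.1 (Nat.find_min hex (by omega)), hb ▸ Nat.find_spec hex⟩

/-- The difference `cum (2 m) - cum m - 2 m` as a function of the state at `m`. -/
def shiftA : StateA → ℤ
  | .eps => 0
  | .s10 | .s101 | .s1000 | .s1100 | .s1110 | .s10111 | .s11011 | .s101010
  | .s111001 | .s1110101 | .s11100111 => -2
  | _ => -1

lemma shift_check : ∀ p, ∀ r ∈ nextA p,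
    shiftA r + 2 + (outA r 2 : ℕ) =
      shiftA p + (outA (stepA p 1) 2 : ℕ) + (outA (stepA r 0) 2 : ℕ) := by
  decide

/-- The partial sums at `m` and at `2 m` determine each other through the state at `m`. -/
lemma cum_two_mul (m : ℕ) : (cum (2 * m) : ℤ) = cum m + 2 * m + shiftA (stateA m) := by
  induction m with
  | zero => rw [stateA_zero]; simp [cum_zero, shiftA]
  | succ m ih =>
    have h := shift_check _ _ (stateA_succ_mem m)
    rw [← stateA_two_mul_add_one, ← stateA_two_mul] at h
    change _ + 2 + (freq (m + 1) : ℤ) = _ + (freq (2 * m + 1) : ℤ) + (freq (2 * (m + 1)) : ℤ) at h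
    have h1 := cum_succ m
    have h2 := cum_succ (2 * m)
    have h3 := cum_succ (2 * m + 1)
    rw [show 2 * m + 1 + 1 = 2 * (m + 1) by ring] at h3
    push_cast
    omega

/-! ### Blocks near a given integer -/

/-- For a state `q` occurring at `m`, the boundary `cum (m - 4 + x) - cum m` for `1 ≤ x ≤ 5`, read
off from the output of `q`.  The output does not contain the lengths of the two blocks beyond; as
they are positive, the value at `0` is an upper bound and the value for `x > 5` a lower bound for
the boundaries at `x = 0` and `x = 6`. -/
def edge (q : StateA) : ℕ → ℤ
  | 0 => -((outA q 0 : ℕ) + (outA q 1 : ℕ) + (outA q 2 : ℕ)) - 1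
  | 1 => -((outA q 0 : ℕ) + (outA q 1 : ℕ) + (outA q 2 : ℕ))
  | 2 => -((outA q 1 : ℕ) + (outA q 2 : ℕ))
  | 3 => -(outA q 2 : ℕ)
  | 4 => 0
  | 5 => (outA q 3 : ℕ)
  | _ => (outA q 3 : ℕ) + 1

/-- A sufficient condition, for a state `q` occurring at `m`, for the integer `cum m + k` to lie in
the block of `m - 3 + x`. -/
def InBlock (q : StateA) (x : ℕ) (k : ℤ) : Prop :=
  x ≤ 5 ∧ edge q x < k ∧ k ≤ edge q (x + 1)

instance (q : StateA) (x : ℕ) (k : ℤ) : Decidable (InBlock q x k) :=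
  inferInstanceAs (Decidable (_ ∧ _ ∧ _))

/-- The number `x` with `InBlock q x k`, if there is one. -/
def locate (q : StateA) (k : ℤ) : ℕ :=
  if k ≤ edge q 1 then 0 else if k ≤ edge q 2 then 1 else if k ≤ edge q 3 then 2
  else if k ≤ 0 then 3 else if k ≤ edge q 5 then 4 else 5

lemma block_of_inBlock {t x : ℕ} {k : ℤ} (h : InBlock (stateA (t + 4)) x k) :
    (cum (t + x) : ℤ) < cum (t + 4) + k ∧ (cum (t + 4) : ℤ) + k ≤ cum (t + x + 1) := by
  obtain ⟨hx, h1, h2⟩ := h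
  have f0 := outA_zero (t + 2)
  have f1 := outA_one (t + 3)
  have f3 := outA_three (t + 4)
  have f2 : (outA (stateA (t + 4)) 2 : ℕ) = freq (t + 4) := rfl
  have p1 := freq_pos (t + 1) (by omega)
  have p6 := freq_pos (t + 6) (by omega)
  have c0 := cum_succ t
  have c1 := cum_succ (t + 1)
  have c2 := cum_succ (t + 2)
  have c3 := cum_succ (t + 3)
  have c4 := cum_succ (t + 4)
  have c5 := cum_succ (t + 5)
  simp only [add_assoc, Nat.reduceAdd] at f0 f1 f2 f3 c0 c1 c2 c3 c4 c5
  interval_cases x <;> simp only [edge, f0, f1, f2, f3] at h1 h2 <;>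
    simp only [add_assoc, Nat.reduceAdd, add_zero] <;> omega

/-! ### The recursion -/

/-- Let `n = cum a - j` lie in the block of `a = 2 m + e`, let `p` be the state at `m`, and suppose
that `V (n - i) = a - 3 + x`, for `i = 1` or `i = 4`.  This is the position `n - V (n - i) - cum m`
of the corresponding argument of `V` relative to `cum m`, as computed from `cum_two_mul`. -/
def argPos (p : StateA) (e j x : ℕ) : ℤ :=
  shiftA p + e * ((outA (stepA p (Fin.ofNat 2 e)) 2 : ℕ) - 1) - j - (x - 3)

/-- The recursion at `n = cum a - j` in the block of `a = 2 m + e`, in terms of the state `p` at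
`m`. The outer calls take the values `m - 3 + locate …`, so that the last equation says
`V (n - V (n - 1)) + V (n - V (n - 4)) = a`. -/
lemma recursion_check : ∀ p : StateA, p ≠ .eps ∧ p ≠ .s1 ∧ p ≠ .s10 → ∀ (e : Fin 2) (j : Fin 5),
    j < outA (stepA p e) 2 →
    InBlock (stepA p e) (locate (stepA p e) (-j - 1)) (-j - 1) ∧
    InBlock (stepA p e) (locate (stepA p e) (-j - 4)) (-j - 4) ∧
    InBlock p (locate p (argPos p e j (locate (stepA p e) (-j - 1))))
      (argPos p e j (locate (stepA p e) (-j - 1))) ∧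
    InBlock p (locate p (argPos p e j (locate (stepA p e) (-j - 4))))
      (argPos p e j (locate (stepA p e) (-j - 4))) ∧
    locate p (argPos p e j (locate (stepA p e) (-j - 1))) +
      locate p (argPos p e j (locate (stepA p e) (-j - 4))) = 6 + e := by
  decide +kernel

lemma hofV_rec (n : ℕ) (hn : 4 < n) (h1 : 1 ≤ hofV (n - 1)) (h4 : 1 ≤ hofV (n - 4)) :
    hofV n = hofV (n - hofV (n - 1)) + hofV (n - hofV (n - 4)) := by
  rw [hofV, dif_neg (by omega), dif_pos ⟨h1, h4⟩]

lemma hofV_initial (n : ℕ) (h1 : 1 ≤ n) (h4 : n ≤ 4) : hofV n = 1 := by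
  rw [hofV, dif_pos h4, if_neg (by omega)]

/-- The first seven blocks, computed directly.  They are excluded from the general step because the
description of the blocks near `m = ⌊(b + 1) / 2⌋` by `edge` reaches down to `cum (m - 4)`. -/
lemma hofV_eq_of_mem_block_of_lt {n b : ℕ} (hb : b < 7) (h1 : cum b < n) (h2 : n ≤ cum (b + 1)) :
    hofV n = b + 1 := by
  have s3 : stateA 3 = .s11 := by simpa [stateA_one, stepA] using stateA_two_mul_add_one 1
  have s4 : stateA 4 = .s100 := by simpa [stateA_of_two, stepA] using stateA_two_mul 2
  have s5 : stateA 5 = .s101 := by simpa [stateA_of_two, stepA] using stateA_two_mul_add_one 2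
  have s6 : stateA 6 = .s110 := by simpa [s3, stepA] using stateA_two_mul 3
  have s7 : stateA 7 = .s111 := by simpa [s3, stepA] using stateA_two_mul_add_one 3
  have c1 : cum 1 = 4 := by rw [cum_succ, cum_zero, freq, stateA_one]; rfl
  have c2 : cum 2 = 5 := by rw [cum_succ, c1, freq, stateA_of_two]; rfl
  have c3 : cum 3 = 6 := by rw [cum_succ, c2, freq, s3]; rfl
  have c4 : cum 4 = 7 := by rw [cum_succ, c3, freq, s4]; rfl
  have c5 : cum 5 = 9 := by rw [cum_succ, c4, freq, s5]; rfl
  have c6 : cum 6 = 11 := by rw [cum_succ, c5, freq, s6]; rfl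
  have c7 : cum 7 = 12 := by rw [cum_succ, c6, freq, s7]; rfl
  have v1 := hofV_initial 1 (by norm_num) (by norm_num)
  have v2 := hofV_initial 2 (by norm_num) (by norm_num)
  have v3 := hofV_initial 3 (by norm_num) (by norm_num)
  have v4 := hofV_initial 4 (by norm_num) (by norm_num)
  have v5 : hofV 5 = 2 := by rw [hofV]; simp [v1, v4]
  have v6 : hofV 6 = 3 := by rw [hofV]; simp [v2, v4, v5]
  have v7 : hofV 7 = 4 := by rw [hofV]; simp [v3, v4, v6]
  have v8 : hofV 8 = 5 := by rw [hofV]; simp [v4, v7]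
  have v9 : hofV 9 = 5 := by rw [hofV]; simp [v4, v5, v7, v8]
  have v10 : hofV 10 = 6 := by rw [hofV]; simp [v5, v6, v7, v9]
  have v11 : hofV 11 = 6 := by rw [hofV]; simp [v5, v7, v10]
  have v12 : hofV 12 = 7 := by rw [hofV]; simp [v6, v7, v8, v11]
  interval_cases b <;> simp only [cum_zero, c1, c2, c3, c4, c5, c6, c7, zero_add, Nat.reduceAdd]
      at h1 h2 <;>
    interval_cases n <;> assumption

/-- The value `b + 1` is taken on the block between the partial sums at `b` and `b + 1`. -/
theorem hofV_eq_of_mem_block {n b : ℕ} (h1 : cum b < n) (h2 : n ≤ cum (b + 1)) :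
    hofV n = b + 1 := by
  induction n using Nat.strong_induction_on generalizing b with
  | _ n ih =>
    by_cases hb : b < 7
    · exact hofV_eq_of_mem_block_of_lt hb h1 h2
    -- The block is that of `b + 1 = 2 m + e` with `m = t + 4`.
    obtain ⟨t, e, hte⟩ : ∃ (t : ℕ) (e : Fin 2), b + 1 = 2 * (t + 4) + e :=
      ⟨(b + 1) / 2 - 4, ⟨(b + 1) % 2, Nat.mod_lt _ two_pos⟩, by simp only; omega⟩
    obtain ⟨s, rfl⟩ : ∃ s, b = s + 3 := ⟨b - 3, by omega⟩
    rw [show s + 3 + 1 = s + 4 from rfl] at h2 hte ⊢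
    set p := stateA (t + 4) with hp
    have hq : stateA (s + 4) = stepA p e := by rw [hte, stateA_two_mul_add]
    have hf : freq (s + 4) = (outA (stepA p e) 2 : ℕ) := by rw [freq, hq]
    have hc : cum (s + 4) = cum (s + 3) + freq (s + 4) := cum_succ (s + 3)
    have hlt := (outA (stepA p e) 2).isLt
    obtain ⟨j, hj⟩ : ∃ j : Fin 5, n + (j : ℕ) = cum (s + 4) :=
      ⟨⟨cum (s + 4) - n, by omega⟩, by simp only; omega⟩
    obtain ⟨i1, i4, k1, k4, hsum⟩ := recursion_check p (stateA_of_three_le _ (by omega)) e j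
      (Fin.lt_def.2 (by omega))
    generalize hx1 : locate (stepA p e) (-j - 1) = x1 at *
    generalize hx4 : locate (stepA p e) (-j - 4) = x4 at *
    generalize hu1 : argPos p e j x1 = u1 at *
    generalize hu4 : argPos p e j x4 = u4 at *
    generalize locate p u1 = y1 at *
    generalize locate p u4 = y4 at *
    rw [← hq] at i1 i4
    have b1 := block_of_inBlock i1
    have b4 := block_of_inBlock i4
    have d1 := block_of_inBlock k1
    have d4 := block_of_inBlock k4
    have w1 : hofV (n - 1) = s + x1 + 1 := ih (n - 1) (by omega) (by omega) (by omega)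
    have w4 : hofV (n - 4) = s + x4 + 1 := ih (n - 4) (by omega) (by omega) (by omega)
    -- The position of `n` relative to `cum m`.
    have hn : (n : ℤ) = cum (t + 4) + 2 * (t + 4 : ℕ) + shiftA p
        + e * (outA (stepA p e) 2 : ℕ) - j := by
      have hd := cum_two_mul (t + 4)
      rw [← hp] at hd
      rcases Fin.exists_fin_two.1 ⟨e, rfl⟩ with rfl | rfl
      · simp only [Fin.val_zero, add_zero] at hte
        rw [hte] at hj
        simp only [Fin.val_zero, Nat.cast_zero, zero_mul]
        omega
      · simp only [Fin.val_one] at hte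
        have := cum_succ (2 * (t + 4))
        rw [← hte, hf] at this
        simp only [Fin.val_one, Nat.cast_one, one_mul]
        omega
    have he : Fin.ofNat 2 (e : ℕ) = e := Fin.ofNat_val_eq_self e
    rw [argPos, he, mul_sub, mul_one] at hu1 hu4
    generalize (e : ℤ) * (outA (stepA p e) 2 : ℕ) = z at *
    rw [hofV_rec n (by omega) (by omega) (by omega), w1, w4,
      ih (n - (s + x1 + 1)) (b := t + y1) (by omega) (by omega) (by omega),
      ih (n - (s + x4 + 1)) (b := t + y4) (by omega) (by omega) (by omega)]
    omega

lemma hofV_eq_iff {n b : ℕ} (hn : 1 ≤ n) : hofV n = b + 1 ↔ cum b < n ∧ n ≤ cum (b + 1) := by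
  refine ⟨fun h => ?_, fun h => hofV_eq_of_mem_block h.1 h.2⟩
  obtain ⟨c, h1, h2⟩ := exists_block n hn
  obtain rfl : c = b := by
    have := hofV_eq_of_mem_block h1 h2
    omega
  exact ⟨h1, h2⟩

lemma hofV_pos {n : ℕ} (hn : 1 ≤ n) : 1 ≤ hofV n := by
  obtain ⟨b, h1, h2⟩ := exists_block n hn
  rw [hofV_eq_of_mem_block h1 h2]
  omega

lemma hofV_le {n : ℕ} (hn : 1 ≤ n) : hofV n ≤ n := by
  obtain ⟨b, h1, h2⟩ := exists_block n hn
  rw [hofV_eq_of_mem_block h1 h2]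
  exact lt_of_le_of_lt cum_strictMono.le_apply h1

lemma setOf_hofV_eq (b : ℕ) :
    {n : ℕ | 1 ≤ n ∧ hofV n = b + 1} = Finset.Ioc (cum b) (cum (b + 1)) := by
  ext n
  simp only [Set.mem_ofPred_eq, Finset.coe_Ioc, Set.mem_Ioc]
  constructor
  · rintro ⟨hn, h⟩
    exact (hofV_eq_iff hn).1 h
  · intro h
    have hn : 1 ≤ n := by omega
    exact ⟨hn, (hofV_eq_iff hn).2 h⟩

lemma finite_setOf_hofV_eq (a : ℕ) : {n : ℕ | 1 ≤ n ∧ hofV n = a}.Finite := by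
  rcases a with _ | b
  · convert Set.finite_empty
    ext n
    simp only [Set.mem_ofPred_eq, Set.mem_empty_iff_false, iff_false]
    rintro ⟨hn, h⟩
    have := hofV_pos hn
    omega
  · rw [setOf_hofV_eq]
    exact Finset.finite_toSet _

lemma hofF_natCast (a : ℕ) : hofF a = freq a := by
  rcases a with _ | b
  · simp [hofF, freq_zero]
  · have h : (1 : ℤ) ≤ (b + 1 : ℕ) := by omega
    simp only [hofF, if_pos h, Nat.cast_inj]
    rw [setOf_hofV_eq, Set.ncard_coe_finset, Nat.card_Ioc, cum_succ]
    omega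

lemma hofF_of_neg {a : ℤ} (ha : a < 0) : hofF a = 0 := if_neg (by omega)

/-- The output of `A` is the window of length four of the frequency sequence. -/
lemma outA_stateA (m : ℕ) (i : Fin 4) : (outA (stateA m) i : ℕ) = hofF ((m : ℤ) - 2 + (i : ℕ)) := by
  have shifted : ∀ {a : ℤ} (b : ℕ), a = b → freq b = hofF a := by
    rintro _ b rfl
    exact (hofF_natCast b).symm
  fin_cases i
  · rcases m with _ | _ | m
    · rw [stateA_zero, hofF_of_neg (by norm_num)]; rfl
    · rw [zero_add, stateA_one, hofF_of_neg (by norm_num)]; rfl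
    · exact (outA_zero m).trans (shifted m (by push_cast; ring))
  · rcases m with _ | m
    · rw [stateA_zero, hofF_of_neg (by norm_num)]; rfl
    · exact (outA_one m).trans (shifted m (by push_cast; ring))
  · exact shifted m (by push_cast; ring)
  · exact (outA_three m).trans (shifted (m + 1) (by push_cast; ring))

/-! ### Minimization -/

/-- The homomorphism from `A`, with the third component as output, onto `B`. -/
def toB : StateA → StateB
  | .eps => .eps
  | .s1 => .s1
  | .s10 => .s10
  | .s11 => .s11
  | .s100 => .s100
  | .s101 | .s1000 => .s101
  | .s110 | .s110101 => .s110
  | .s111 => .s111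
  | .s1010 => .s1010
  | .s1011 | .s10110 | .s11101 | .s111010 | .s1110100 | .s11101000 => .s1011
  | .s1100 | .s10111 | .s1110101 => .s1100
  | .s1101 => .s1101
  | .s1110 | .s101010 => .s1110
  | .s10101 | .s101011 => .s10101
  | .s11010 => .s11010
  | .s11011 => .s11011
  | .s11100 | .s1010100 => .s11100
  | .s111001 => .s111001
  | .s1110011 | .s111001111 => .s1110011
  | .s11100111 => .s11100111

lemma toB_step : ∀ q a, toB (stepA q a) = stepB (toB q) a := by decide

lemma outB_toB : ∀ q, outB (toB q) = outA q 2 := by decide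

/-- A word that leads from the initial state to the given state: its name. -/
def accessA : StateA → List (Fin 2)
  | .eps => []
  | .s1 => [1]
  | .s10 => [1, 0]
  | .s11 => [1, 1]
  | .s100 => [1, 0, 0]
  | .s101 => [1, 0, 1]
  | .s110 => [1, 1, 0]
  | .s111 => [1, 1, 1]
  | .s1000 => [1, 0, 0, 0]
  | .s1010 => [1, 0, 1, 0]
  | .s1011 => [1, 0, 1, 1]
  | .s1100 => [1, 1, 0, 0]
  | .s1101 => [1, 1, 0, 1]
  | .s1110 => [1, 1, 1, 0]
  | .s10101 => [1, 0, 1, 0, 1]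
  | .s10110 => [1, 0, 1, 1, 0]
  | .s10111 => [1, 0, 1, 1, 1]
  | .s11010 => [1, 1, 0, 1, 0]
  | .s11011 => [1, 1, 0, 1, 1]
  | .s11100 => [1, 1, 1, 0, 0]
  | .s11101 => [1, 1, 1, 0, 1]
  | .s101010 => [1, 0, 1, 0, 1, 0]
  | .s101011 => [1, 0, 1, 0, 1, 1]
  | .s110101 => [1, 1, 0, 1, 0, 1]
  | .s111001 => [1, 1, 1, 0, 0, 1]
  | .s111010 => [1, 1, 1, 0, 1, 0]
  | .s1010100 => [1, 0, 1, 0, 1, 0, 0]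
  | .s1110011 => [1, 1, 1, 0, 0, 1, 1]
  | .s1110100 => [1, 1, 1, 0, 1, 0, 0]
  | .s1110101 => [1, 1, 1, 0, 1, 0, 1]
  | .s11100111 => [1, 1, 1, 0, 0, 1, 1, 1]
  | .s11101000 => [1, 1, 1, 0, 1, 0, 0, 0]
  | .s111001111 => [1, 1, 1, 0, 0, 1, 1, 1, 1]

lemma eval_accessA : ∀ q, autA.eval (accessA q) = q := by decide

lemma toB_evalFrom (q : StateA) (w : List (Fin 2)) :
    toB (autA.evalFrom q w) = autB.evalFrom (toB q) w := by
  induction w generalizing q with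
  | nil => rfl
  | cons a w ih =>
    change toB (autA.evalFrom (stepA q a) w) = autB.evalFrom (stepB (toB q) a) w
    rw [ih, toB_step]

lemma toB_surjective : Function.Surjective toB := by
  unfold Function.Surjective; decide

/-- The outputs on five words separate the states of `B`. -/
def fingerprint (q : StateB) : List (Fin 5) :=
  [[], [0], [1], [0, 0, 1, 0], [1, 1, 1, 0]].map fun w => autB.out (autB.evalFrom q w)

lemma fingerprint_injective : ∀ p q, fingerprint p = fingerprint q → p = q := by
  decide

lemma eq_of_forall_out_eq {p q : StateB}
    (h : ∀ w, autB.out (autB.evalFrom p w) = autB.out (autB.evalFrom q w)) : p = q :=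
  fingerprint_injective p q (by simp only [fingerprint, h])

lemma autB_eval (w : List (Fin 2)) : autB.eval w = toB (autA.eval w) :=
  (toB_evalFrom .eps w).symm

lemma out_minimized (q : StateA) (w : List (Fin 2)) :
    (autA.mapOut fun t => t 2).out ((autA.mapOut fun t => t 2).evalFrom q w) =
      autB.out (autB.evalFrom (toB q) w) := by
  rw [← toB_evalFrom]
  exact (outB_toB _).symm

lemma autB_isIsomorphic : autB.IsIsomorphic (autA.mapOut fun t => t 2).minimize := by
  let f : Quotient (autA.mapOut fun t => t 2).stateSetoid → StateB :=
    Quotient.lift (fun q => toB q.1) fun p q h => eq_of_forall_out_eq fun w => by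
      rw [← out_minimized, ← out_minimized]
      exact h w
  have hf : Function.Bijective f := by
    constructor
    · rintro ⟨p⟩ ⟨q⟩ h
      refine Quotient.sound fun w => ?_
      change toB p.1 = toB q.1 at h
      rw [out_minimized, out_minimized, h]
    · intro b
      obtain ⟨q, rfl⟩ := toB_surjective b
      exact ⟨Quotient.mk _ ⟨q, accessA q, eval_accessA q⟩, rfl⟩
  let g := Equiv.ofBijective f hf
  refine ⟨g.symm, ?_, fun q a => ?_, fun q => ?_⟩
  · rw [Equiv.symm_apply_eq]
    rfl
  · rw [Equiv.symm_apply_eq]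
    obtain ⟨c, rfl⟩ := g.surjective q
    rw [Equiv.symm_apply_apply]
    induction c using Quotient.inductionOn with
    | _ c => exact (toB_step c.1 a).symm
  · obtain ⟨c, rfl⟩ := g.surjective q
    rw [Equiv.symm_apply_apply]
    induction c using Quotient.inductionOn with
    | _ c => exact (outB_toB c.1).symm

lemma outB_eval (w : List (Fin 2)) :
    ((autB.out (autB.eval w) : Fin 5) : ℕ) = hofF (binValue w) := by
  rw [autB_eval, autA_eval, hofF_natCast, freq, ← outB_toB]
  rfl

/-- An automaton with the same outputs as `B` has at least as many states, since words leading to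
different states of `B` lead to different states of it. -/
lemma card_stateB_le {σ : Type*} [Fintype σ] (M : DFAO (Fin 2) σ (Fin 5))
    (hM : ∀ w, M.out (M.eval w) = autB.out (autB.eval w)) :
    Fintype.card StateB ≤ Fintype.card σ := by
  have hreach : ∀ b : StateB, ∃ w, autB.eval w = b := fun b => by
    obtain ⟨q, rfl⟩ := toB_surjective b
    exact ⟨accessA q, by rw [autB_eval, eval_accessA]⟩
  choose access haccess using hreach
  refine Fintype.card_le_of_injective (fun b => M.eval (access b)) fun p q h => ?_
  refine eq_of_forall_out_eq fun w => ?_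
  rw [← haccess p, ← haccess q, ← DFAO.eval_append, ← DFAO.eval_append, ← hM, ← hM,
    DFAO.eval_append, DFAO.eval_append]
  simp only at h
  rw [h]

theorem mainTheorem3 :
    -- `V` and `F` are well defined: `V` satisfies its recursion, with all indices in range,
    -- and every value is taken finitely often
    ((∀ n : ℕ, 1 ≤ n → n ≤ 4 → hofV n = 1) ∧
      (∀ n : ℕ, 4 < n →
        1 ≤ hofV (n - 1) ∧ hofV (n - 1) < n ∧ 1 ≤ hofV (n - 4) ∧ hofV (n - 4) < n ∧
          hofV n = hofV (n - hofV (n - 1)) + hofV (n - hofV (n - 4))) ∧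
      (∀ a : ℕ, {n : ℕ | 1 ≤ n ∧ hofV n = a}.Finite)) ∧
    -- `A` has 33 states and computes the blocks `F(n-2), F(n-1), F(n), F(n+1)`
    (Fintype.card StateA = 33 ∧
      ∀ (w : List (Fin 2)) (i : Fin 4),
        ((autA.out (autA.eval w) i : Fin 5) : ℕ) = hofF ((binValue w : ℤ) - 2 + (i : ℕ))) ∧
    -- `B` has 20 states and is the minimization of `A` with the output projected to the third
    -- component (the component of index 2, counted from 0)
    (Fintype.card StateB = 20 ∧
      autB.IsIsomorphic (autA.mapOut (fun t => t 2)).minimize) ∧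
    -- `B` computes `F(n)`
    (∀ w : List (Fin 2), ((autB.out (autB.eval w) : Fin 5) : ℕ) = hofF (binValue w)) ∧
    -- no automaton with fewer states computes `F(n)`
    (∀ (σ : Type*) [Fintype σ] (M : DFAO (Fin 2) σ (Fin 5)),
      (∀ w : List (Fin 2), ((M.out (M.eval w) : Fin 5) : ℕ) = hofF (binValue w)) →
        20 ≤ Fintype.card σ) := by
  refine ⟨⟨hofV_initial, fun n hn => ?_, finite_setOf_hofV_eq⟩, ⟨rfl, fun w i => ?_⟩,
    ⟨rfl, autB_isIsomorphic⟩, outB_eval, fun σ _ M hM => ?_⟩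
  · have p1 : 1 ≤ hofV (n - 1) := hofV_pos (by omega)
    have p4 : 1 ≤ hofV (n - 4) := hofV_pos (by omega)
    have l1 : hofV (n - 1) ≤ n - 1 := hofV_le (by omega)
    have l4 : hofV (n - 4) ≤ n - 4 := hofV_le (by omega)
    exact ⟨p1, by omega, p4, by omega, hofV_rec n hn p1 p4⟩
  · rw [autA_eval]
    exact outA_stateA _ _
  · exact card_stateB_le M fun w => Fin.ext ((hM w).trans (outB_eval w).symm)
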